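/- All spaces and algebras are over $\mathbb{C}$. For a discrete group $G$, $\ell^1(G)$ is the Banach algebra of absolutely summable functions $G\to\mathbb{C}$ with the $\ell^1$-norm and convolution $(f*g)(x)=\sum_{y\in G} f(y)\,g(y^{-1}x)$. A Banach bimodule $X$ over a Banach algebra $A$ is a Banach space with commuting associative left and right actions of $A$ that are bounded bilinear maps (the actions need not be unital). The dual $X^*$ is a Banach $A$-bimodule via $\langle x,a\cdot\varphi\rangle=\langle x\cdot a,\varphi\rangle$ and $\langle x,\varphi\cdot a\rangle=\langle a\cdot x,\varphi\rangle$. For a Banach $A$-bimodule $Y$ let $\mathcal{BL}^n(A,Y)$ be the space of bounded $n$-linear maps from $A$ to $Y$, and let $\delta^n:\mathcal{BL}^n(A,Y)\to\mathcal{BL}^{n+1}(A,Y)$ be the Hochschild coboundary $$(\delta^nT)(a_1,\dots,a_{n+1})=a_1\cdot T(a_2,\dots,a_{n+1})+\sum_{k=1}^n(-1)^kT(a_1,\dots,a_ka_{k+1},\dots,a_{n+1})+(-1)^{n+1}T(a_1,\dots,a_n)\cdot a_{n+1}.$$ For $n\ge 1$ put $\mathcal{Z}^n(A,Y)=\ker\delta^n$,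 $\mathcal{B}^n(A,Y)=\operatorname{ran}\delta^{n-1}$ and $$\mathcal{H}^n_{app}(A,Y)=\mathcal{Z}^n(A,Y)\big/\overline{\mathcal{B}^n(A,Y)},$$ where the closure is taken in the strong topology of $\mathcal{BL}^n(A,Y)$, in which $T_i\to T$ if and only if $\|(T_i-T)(a_1,\dots,a_n)\|\to 0$ for all $a_1,\dots,a_n\in A$. Proposition. Let $H$ be a subgroup of a discrete group $G$. If $\mathcal{H}^2_{app}(\ell^1(G),X^*)=\{0\}$ for all Banach $\ell^1(G)$-bimodules $X$, then $\mathcal{H}^2_{app}(\ell^1(H),X^*)=\{0\}$ for all Banach $\ell^1(H)$-bimodules $X$. -/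

import Mathlib

open scoped ENNReal Topology

universe u v

noncomputable section

/-! ### The convolution algebra `ℓ¹(G)` of a discrete group -/

/-- The Banach space `ℓ¹(G)` of absolutely summable functions `G → ℂ`. -/
abbrev L1 (G : Type u) : Type u := lp (fun _ : G => ℂ) 1

namespace L1

variable {G : Type u}

lemma summable_norm (f : L1 G) : Summable fun x => ‖f x‖ := by
  simpa using (lp.memℓp f).summable (by simp)

lemma norm_eq (f : L1 G) : ‖f‖ = ∑' x, ‖f x‖ := by
  simpa using lp.norm_eq_tsum_rpow (p := 1) (by simp) f

variable [Group G]

/-- The shear `(x, y) ↦ (y, y⁻¹ x)`. -/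
def shear (G : Type u) [Group G] : G × G ≃ G × G where
  toFun p := (p.2, p.2⁻¹ * p.1)
  invFun q := (q.1 * q.2, q.1)
  left_inv p := by simp
  right_inv q := by simp

lemma summable_shear_norm (f g : L1 G) :
    Summable fun p : G × G => ‖f p.2 * g (p.2⁻¹ * p.1)‖ := by
  have h : Summable fun q : G × G => ‖f q.1 * g q.2‖ := by
    simpa using f.summable_norm.mul_norm g.summable_norm
  exact (shear G).summable_iff.mpr h

lemma summable_conv_norm (f g : L1 G) (x : G) : Summable fun y => ‖f y * g (y⁻¹ * x)‖ :=
  (summable_shear_norm f g).prod_factor x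

lemma summable_conv (f g : L1 G) (x : G) : Summable fun y => f y * g (y⁻¹ * x) :=
  (summable_conv_norm f g x).of_norm

lemma summable_norm_conv (f g : L1 G) :
    Summable fun x => ‖∑' y, f y * g (y⁻¹ * x)‖ :=
  Summable.of_nonneg_of_le (fun _ => norm_nonneg _)
    (fun x => norm_tsum_le_tsum_norm (summable_conv_norm f g x)) (summable_shear_norm f g).prod

/-- Convolution: `(f * g)(x) = ∑ y, f(y) g(y⁻¹ x)`. -/
instance : Mul (L1 G) where
  mul f g := ⟨fun x => ∑' y, f y * g (y⁻¹ * x),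
    memℓp_gen (by simpa using summable_norm_conv f g)⟩

lemma mul_apply (f g : L1 G) (x : G) : (f * g) x = ∑' y, f y * g (y⁻¹ * x) := rfl

lemma norm_mul_le' (f g : L1 G) : ‖f * g‖ ≤ ‖f‖ * ‖g‖ := by
  have h : Summable fun q : G × G => ‖f q.1 * g q.2‖ := by
    simpa using f.summable_norm.mul_norm g.summable_norm
  calc ‖f * g‖ = ∑' x, ‖∑' y, f y * g (y⁻¹ * x)‖ := norm_eq _
    _ ≤ ∑' x, ∑' y, ‖f y * g (y⁻¹ * x)‖ :=
        (summable_norm_conv f g).tsum_le_tsum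
          (fun x => norm_tsum_le_tsum_norm (summable_conv_norm f g x))
          (summable_shear_norm f g).prod
    _ = ∑' p : G × G, ‖f p.2 * g (p.2⁻¹ * p.1)‖ := (summable_shear_norm f g).tsum_prod.symm
    _ = ∑' q : G × G, ‖f q.1 * g q.2‖ :=
        (shear G).tsum_eq (fun q : G × G => ‖f q.1 * g q.2‖)
    _ = ‖f‖ * ‖g‖ := by
        rw [norm_eq, norm_eq, h.tsum_prod]
        simp only [norm_mul, tsum_mul_left, tsum_mul_right]

lemma mul_assoc' (f g k : L1 G) : f * g * k = f * (g * k) := by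
  ext x
  have hs : Summable fun p : G × G => f p.2 * g (p.2⁻¹ * p.1) * k (p.1⁻¹ * x) := by
    refine Summable.of_norm_bounded ((summable_shear_norm f g).mul_right ‖k‖) fun p => ?_
    rw [norm_mul]
    gcongr
    exact lp.norm_apply_le_norm one_ne_zero k _
  calc (f * g * k) x
      = ∑' z, ∑' y, f y * g (y⁻¹ * z) * k (z⁻¹ * x) := by
        simp only [mul_apply, tsum_mul_right]
    _ = ∑' y, ∑' z, f y * g (y⁻¹ * z) * k (z⁻¹ * x) :=
        Summable.tsum_comm (f := fun y z => f y * g (y⁻¹ * z) * k (z⁻¹ * x)) hs.prod_symm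
    _ = ∑' y, f y * ∑' z, g z * k (z⁻¹ * (y⁻¹ * x)) := by
        refine tsum_congr fun y => ?_
        rw [← tsum_mul_left, ← (Equiv.mulLeft y).tsum_eq]
        refine tsum_congr fun z => ?_
        simp [mul_assoc]
    _ = (f * (g * k)) x := rfl

/-- `ℓ¹(G)` is a Banach algebra under convolution. -/
instance : NonUnitalNormedRing (L1 G) where
  __ := (inferInstance : NormedAddCommGroup (L1 G))
  mul f g := f * g
  left_distrib f g k := by
    ext x
    simp only [lp.coeFn_add, Pi.add_apply, mul_apply, mul_add]
    exact (summable_conv f g x).tsum_add (summable_conv f k x)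
  right_distrib f g k := by
    ext x
    simp only [lp.coeFn_add, Pi.add_apply, mul_apply, add_mul]
    exact (summable_conv f k x).tsum_add (summable_conv g k x)
  zero_mul f := by ext x; simp [mul_apply]
  mul_zero f := by ext x; simp [mul_apply]
  mul_assoc := mul_assoc'
  norm_mul_le := norm_mul_le'

instance : IsScalarTower ℂ (L1 G) (L1 G) where
  smul_assoc c f g := by
    ext x
    simp only [smul_eq_mul, lp.coeFn_smul, Pi.smul_apply, mul_apply, mul_assoc, tsum_mul_left]

instance : SMulCommClass ℂ (L1 G) (L1 G) where
  smul_comm c f g := by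
    ext x
    simp only [smul_eq_mul, lp.coeFn_smul, Pi.smul_apply, mul_apply, mul_left_comm _ c,
      tsum_mul_left]

end L1

/-! ### Banach bimodules -/

/-- A Banach `A`-bimodule structure on `X`: commuting left and right actions
`(a, x) ↦ a · x` and `(a, x) ↦ x · a` that are bounded bilinear maps. No unit is required in
`A`, and no unitality of the actions. -/
structure BanachBimodule (A : Type u) (X : Type v)
    [NonUnitalNormedRing A] [NormedSpace ℂ A] [NormedAddCommGroup X] [NormedSpace ℂ X] where
  /-- `left a x = a · x` -/
  left : A →L[ℂ] X →L[ℂ] X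
  /-- `right a x = x · a` -/
  right : A →L[ℂ] X →L[ℂ] X
  left_mul : ∀ a b x, left (a * b) x = left a (left b x)
  right_mul : ∀ a b x, right (a * b) x = right b (right a x)
  left_right : ∀ a b x, left a (right b x) = right b (left a x)

namespace BanachBimodule

variable {A : Type u} {X : Type v}
  [NonUnitalNormedRing A] [NormedSpace ℂ A] [NormedAddCommGroup X] [NormedSpace ℂ X]

/-- The dual bimodule `X*`: `⟨x, a · φ⟩ = ⟨x · a, φ⟩` and `⟨x, φ · a⟩ = ⟨a · x, φ⟩`. -/
def dual (M : BanachBimodule A X) : BanachBimodule A (StrongDual ℂ X) where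
  left := (ContinuousLinearMap.compL ℂ X X ℂ).flip ∘L M.right
  right := (ContinuousLinearMap.compL ℂ X X ℂ).flip ∘L M.left
  left_mul a b φ := by ext x; simp [M.right_mul]
  right_mul a b φ := by ext x; simp [M.left_mul]
  left_right a b φ := by ext x; simp [M.left_right]

lemma dual_left_apply (M : BanachBimodule A X) (a : A) (φ : StrongDual ℂ X) (x : X) :
    M.dual.left a φ x = φ (M.right a x) := rfl

lemma dual_right_apply (M : BanachBimodule A X) (a : A) (φ : StrongDual ℂ X) (x : X) :
    M.dual.right a φ x = φ (M.left a x) := rfl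

end BanachBimodule

/-! ### The Hochschild cochain complex -/

/-- `BL n A X` is the space of bounded `n`-linear maps from `A` to `X`. -/
abbrev BL (n : ℕ) (A : Type u) (X : Type v)
    [NonUnitalNormedRing A] [NormedSpace ℂ A] [NormedAddCommGroup X] [NormedSpace ℂ X] :
    Type (max u v) :=
  ContinuousMultilinearMap ℂ (fun _ : Fin n => A) X

namespace BanachBimodule

variable {A : Type u} {X : Type v}
  [NonUnitalNormedRing A] [NormedSpace ℂ A] [NormedAddCommGroup X] [NormedSpace ℂ X]

lemma continuous_contractNth {A : Type u} [NonUnitalNormedRing A] {n : ℕ} (j : Fin n) :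
    Continuous fun a : Fin (n + 1) → A => Fin.contractNth j.castSucc (· * ·) a := by
  refine continuous_pi fun k => ?_
  unfold Fin.contractNth
  split_ifs <;> fun_prop

/-- The value `(δⁿT)(a₁, …, aₙ₊₁) = a₁ · T(a₂, …, aₙ₊₁)
  + ∑_{k=1}^{n} (-1)^k T(a₁, …, aₖaₖ₊₁, …, aₙ₊₁) + (-1)^{n+1} T(a₁, …, aₙ) · aₙ₊₁`;
`Fin.contractNth j (· * ·) a` multiplies the entries of `a` in the (zero-based) places
`j` and `j + 1`. -/
def coboundaryFun (M : BanachBimodule A X) {n : ℕ} (T : BL n A X) (a : Fin (n + 1) → A) : X :=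
  M.left (a 0) (T (Fin.tail a))
    + ∑ j : Fin n, (-1 : ℂ) ^ ((j : ℕ) + 1) • T (Fin.contractNth j.castSucc (· * ·) a)
    + (-1 : ℂ) ^ (n + 1) • M.right (a (Fin.last n)) (T (Fin.init a))

variable [IsScalarTower ℂ A A] [SMulCommClass ℂ A A]

/-- As a function of one entry of `a`, the tuple contracted at `j` changes in one entry only,
and linearly. -/
lemma contractNth_update {n : ℕ} (j : Fin n) (a : Fin (n + 1) → A) (i : Fin (n + 1)) :
    ∃ (i' : Fin n) (L : A →ₗ[ℂ] A), ∀ x,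
      Fin.contractNth j.castSucc (· * ·) (Function.update a i x) =
        Function.update (Fin.contractNth j.castSucc (· * ·) a) i' (L x) := by
  rcases lt_trichotomy (i : ℕ) j with h | h | h
  · refine ⟨⟨i, by omega⟩, LinearMap.id, fun x => ?_⟩
    ext1 k
    simp only [Fin.contractNth, Function.update_apply, Fin.ext_iff, Fin.val_castSucc,
      Fin.val_succ, LinearMap.id_apply]
    grind
  · refine ⟨j, LinearMap.mulRight ℂ (a j.succ), fun x => ?_⟩
    ext1 k
    simp only [Fin.contractNth, Function.update_apply, Fin.ext_iff, Fin.val_castSucc,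
      Fin.val_succ, LinearMap.mulRight_apply]
    grind
  · by_cases h' : (i : ℕ) = j + 1
    · refine ⟨j, LinearMap.mulLeft ℂ (a j.castSucc), fun x => ?_⟩
      ext1 k
      simp only [Fin.contractNth, Function.update_apply, Fin.ext_iff, Fin.val_castSucc,
        Fin.val_succ, LinearMap.mulLeft_apply]
      grind
    · refine ⟨⟨i - 1, by omega⟩, LinearMap.id, fun x => ?_⟩
      ext1 k
      simp only [Fin.contractNth, Function.update_apply, Fin.ext_iff, Fin.val_castSucc,
        Fin.val_succ, LinearMap.id_apply]
      grind

lemma coboundaryFun_update (M : BanachBimodule A X) {n : ℕ} (T : BL n A X)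
    (a : Fin (n + 1) → A) (i : Fin (n + 1)) :
    ∃ L : A →ₗ[ℂ] X, ∀ x, M.coboundaryFun T (Function.update a i x) = L x := by
  have h1 : ∃ L : A →ₗ[ℂ] X, ∀ x,
      M.left (Function.update a i x 0) (T (Fin.tail (Function.update a i x))) = L x := by
    refine Fin.cases ?_ (fun i => ?_) i
    · exact ⟨((M.left.flip (T (Fin.tail a))) : A →ₗ[ℂ] X), fun x => by
        simp [Fin.tail_update_zero]⟩
    · exact ⟨(M.left (a 0) : X →ₗ[ℂ] X) ∘ₗ T.toMultilinearMap.toLinearMap (Fin.tail a) i,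
        fun x => by simp [Fin.tail_update_succ, Function.update_of_ne (Fin.succ_ne_zero i).symm]⟩
  have h2 : ∀ j : Fin n, ∃ L : A →ₗ[ℂ] X, ∀ x,
      T (Fin.contractNth j.castSucc (· * ·) (Function.update a i x)) = L x := by
    intro j
    obtain ⟨i', L, hL⟩ := contractNth_update j a i
    exact ⟨T.toMultilinearMap.toLinearMap (Fin.contractNth j.castSucc (· * ·) a) i' ∘ₗ L,
      fun x => by simp [hL]⟩
  have h3 : ∃ L : A →ₗ[ℂ] X, ∀ x,
      M.right (Function.update a i x (Fin.last n)) (T (Fin.init (Function.update a i x))) =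
        L x := by
    refine Fin.lastCases ?_ (fun i => ?_) i
    · exact ⟨((M.right.flip (T (Fin.init a))) : A →ₗ[ℂ] X), fun x => by
        simp [Fin.init_update_last]⟩
    · exact ⟨(M.right (a (Fin.last n)) : X →ₗ[ℂ] X) ∘ₗ
          T.toMultilinearMap.toLinearMap (Fin.init a) i,
        fun x => by
          simp [Fin.init_update_castSucc, Function.update_of_ne (Fin.castSucc_ne_last i).symm]⟩
  obtain ⟨L1, h1⟩ := h1
  choose L2 h2 using h2
  obtain ⟨L3, h3⟩ := h3
  refine ⟨L1 + ∑ j : Fin n, (-1 : ℂ) ^ ((j : ℕ) + 1) • L2 j + (-1 : ℂ) ^ (n + 1) • L3,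
    fun x => ?_⟩
  simp [coboundaryFun, h1, h2, h3]

/-- The Hochschild coboundary operator `δⁿ : BLⁿ(A, X) → BLⁿ⁺¹(A, X)`. -/
def coboundary (M : BanachBimodule A X) (n : ℕ) : BL n A X →ₗ[ℂ] BL (n + 1) A X where
  toFun T :=
    { toFun := M.coboundaryFun T
      map_update_add' := fun {inst} a i x y => by
        obtain rfl : inst = instDecidableEqFin (n + 1) := Subsingleton.elim _ _
        obtain ⟨L, hL⟩ := M.coboundaryFun_update T a i
        simp only [hL, map_add]
      map_update_smul' := fun {inst} a i c x => by
        obtain rfl : inst = instDecidableEqFin (n + 1) := Subsingleton.elim _ _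
        obtain ⟨L, hL⟩ := M.coboundaryFun_update T a i
        simp only [hL, map_smul]
      cont := by
        have h1 : Continuous fun a : Fin (n + 1) → A => T (Fin.tail a) :=
          T.cont.comp (continuous_pi fun k => continuous_apply _)
        have h2 : Continuous fun a : Fin (n + 1) → A => T (Fin.init a) :=
          T.cont.comp (continuous_pi fun k => continuous_apply _)
        have h3 : ∀ j : Fin n, Continuous fun a : Fin (n + 1) → A =>
            T (Fin.contractNth j.castSucc (· * ·) a) :=
          fun j => T.cont.comp (continuous_contractNth j)
        change Continuous fun a => M.coboundaryFun T a
        unfold coboundaryFun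
        have h4 : Continuous fun a : Fin (n + 1) → A => M.left (a 0) (T (Fin.tail a)) :=
          (M.left.continuous.comp (continuous_apply 0)).clm_apply h1
        have h5 : Continuous fun a : Fin (n + 1) → A =>
            M.right (a (Fin.last n)) (T (Fin.init a)) :=
          (M.right.continuous.comp (continuous_apply (Fin.last n))).clm_apply h2
        exact (h4.add (continuous_finsetSum _ fun j _ => (h3 j).const_smul _)).add
          (h5.const_smul _) }
  map_add' S T := by
    ext a
    change M.coboundaryFun (S + T) a = M.coboundaryFun S a + M.coboundaryFun T a
    simp only [coboundaryFun, add_apply, map_add, smul_add,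
      Finset.sum_add_distrib]
    abel
  map_smul' c T := by
    ext a
    change M.coboundaryFun (c • T) a = c • M.coboundaryFun T a
    simp only [coboundaryFun, smul_apply, map_smul, smul_add,
      Finset.smul_sum, smul_comm c]

lemma coboundary_apply (M : BanachBimodule A X) {n : ℕ} (T : BL n A X) (a : Fin (n + 1) → A) :
    M.coboundary n T a = M.left (a 0) (T (Fin.tail a))
      + ∑ j : Fin n, (-1 : ℂ) ^ ((j : ℕ) + 1) • T (Fin.contractNth j.castSucc (· * ·) a)
      + (-1 : ℂ) ^ (n + 1) • M.right (a (Fin.last n)) (T (Fin.init a)) := rfl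

/-- The `n`-cocycles `Zⁿ(A, X) = ker δⁿ`. -/
def cocycles (M : BanachBimodule A X) (n : ℕ) : Submodule ℂ (BL n A X) :=
  LinearMap.ker (M.coboundary n)

/-- The `n`-coboundaries `Bⁿ(A, X) = ran δⁿ⁻¹` (and `B⁰ = 0`). -/
def coboundaries (M : BanachBimodule A X) : (n : ℕ) → Submodule ℂ (BL n A X)
  | 0 => ⊥
  | n + 1 => LinearMap.range (M.coboundary n)

end BanachBimodule

/-! ### Approximate Hochschild cohomology -/

section Approximate

variable {A : Type u} {X : Type v}
  [NonUnitalNormedRing A] [NormedSpace ℂ A] [NormedAddCommGroup X] [NormedSpace ℂ X]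

/-- The strong topology on `BLⁿ(A, X)`: a net `T_i` converges to `T` iff
`‖(T_i - T)(a₁, …, aₙ)‖ → 0` for all `a₁, …, aₙ ∈ A`. -/
abbrev strongTopology (n : ℕ) (A : Type u) (X : Type v)
    [NonUnitalNormedRing A] [NormedSpace ℂ A] [NormedAddCommGroup X] [NormedSpace ℂ X] :
    TopologicalSpace (BL n A X) :=
  TopologicalSpace.induced (fun T : BL n A X => (T : (Fin n → A) → X)) Pi.topologicalSpace

/-- The closure of a subspace of `BLⁿ(A, X)` in the strong topology. -/
def strongClosure {n : ℕ} (S : Submodule ℂ (BL n A X)) : Submodule ℂ (BL n A X) :=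
  letI : TopologicalSpace (BL n A X) := strongTopology n A X
  let ev : BL n A X →ₗ[ℂ] ((Fin n → A) → X) :=
    { toFun := fun T => T, map_add' := fun _ _ => rfl, map_smul' := fun _ _ => rfl }
  have key : closure (S : Set (BL n A X)) = ev ⁻¹' ((S.map ev).topologicalClosure : Set _) := by
    ext T
    exact closure_induced (f := fun T : BL n A X => (T : (Fin n → A) → X))
  { carrier := closure (S : Set (BL n A X))
    add_mem' := fun {a b} ha hb => by
      rw [key] at ha hb ⊢
      exact ((S.map ev).topologicalClosure.comap ev).add_mem ha hb
    zero_mem' := subset_closure S.zero_mem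
    smul_mem' := fun c {a} ha => by
      rw [key] at ha ⊢
      exact ((S.map ev).topologicalClosure.comap ev).smul_mem c ha }

lemma coe_strongClosure {n : ℕ} (S : Submodule ℂ (BL n A X)) :
    (strongClosure S : Set (BL n A X)) = closure[strongTopology n A X] (S : Set (BL n A X)) :=
  rfl

/-- The `n`-th approximate Hochschild cohomology: the quotient of `Zⁿ(A, X)` by the strong
closure of `Bⁿ(A, X)`. -/
abbrev HApp [IsScalarTower ℂ A A] [SMulCommClass ℂ A A] (n : ℕ) (M : BanachBimodule A X) :
    Type (max u v) :=
  M.cocycles n ⧸ (strongClosure (M.coboundaries n)).submoduleOf (M.cocycles n)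

end Approximate

end

/-!
Let `N` be a dual `ℓ¹(H)`-bimodule and `T` an `n`-cocycle on `ℓ¹(H)` with values in `N`. The idea
is to realise `T`, up to a coboundary, as the image of a cocycle on `ℓ¹(G)` with values in the
coinduced bimodule: the bounded bilinear maps `F : ℓ¹(G) × ℓ¹(G) → N` such that
`F(k * a, b) = k · F(a, b)` and `F(a, b * k) = F(a, b) · k` for `k ∈ ℓ¹(H)`.

In homogeneous form a cocycle is a function of `n + 1` group elements, and it can be pulled back
along any left `H`-equivariant map `r : G → H`. Choosing `r` to restrict to the identity of `H`, the
pullback `F` of `T` evaluates at `(δ₁, δ₁)` to the compressed cocycle `δ₁ · T · δ₁`, which differs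
from `T` by a coboundary.

The hypothesis on `G` is applied to the bidual `E**` of the coinduced bimodule `E`, so that no
predual of `E` has to be identified: `F` is approximately a coboundary in `E**`, and evaluation at
`(δ₁, δ₁)` extends to a bimodule map `E** → N` because `N` is a dual bimodule.
-/

noncomputable section

namespace L1

section UniversalProperty

variable {S : Type*} {V : Type*} [NormedAddCommGroup V] [NormedSpace ℂ V]

open Classical in
/-- The point mass at `s`. -/
def delta (s : S) : L1 S := lp.single 1 s (1 : ℂ)

open Classical in
lemma delta_apply (s t : S) : delta s t = if t = s then 1 else 0 := by
  simp [delta, Pi.single_apply]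

lemma norm_delta (s : S) : ‖delta s‖ = 1 := by
  simp [delta, lp.norm_single]

lemma clm_ext {f g : L1 S →L[ℂ] V} (h : ∀ s, f (delta s) = g (delta s)) : f = g := by
  classical
  refine lp.ext_continuousLinearMap ENNReal.one_ne_top fun s => ?_
  ext
  exact h s

lemma bilinear_ext {S' : Type*} {f g : L1 S →L[ℂ] L1 S' →L[ℂ] V}
    (h : ∀ s t, f (delta s) (delta t) = g (delta s) (delta t)) : f = g :=
  clm_ext fun s => clm_ext fun t => h s t

lemma summable_norm_smul {f : S → V} {C : ℝ} (hf : ∀ s, ‖f s‖ ≤ C) (a : L1 S) :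
    Summable fun s => ‖a s • f s‖ := by
  refine Summable.of_nonneg_of_le (fun _ => norm_nonneg _) (fun s => ?_)
    (a.summable_norm.mul_right C)
  grw [norm_smul, hf s]

variable [CompleteSpace V]

/-- The bounded linear map `ℓ¹(S) → V` that extends a function on `S` bounded by `C`. -/
def lift (f : S → V) (C : ℝ) (hf : ∀ s, ‖f s‖ ≤ C) : L1 S →L[ℂ] V :=
  LinearMap.mkContinuous
    { toFun := fun a => ∑' s, a s • f s
      map_add' := fun a b => by
        simp only [lp.coeFn_add, Pi.add_apply, add_smul]
        exact (summable_norm_smul hf a).of_norm.tsum_add (summable_norm_smul hf b).of_norm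
      map_smul' := fun c a => by
        simp only [lp.coeFn_smul, Pi.smul_apply, smul_assoc, RingHom.id_apply]
        exact (summable_norm_smul hf a).of_norm.tsum_const_smul c } C fun a =>
    calc ‖∑' s, a s • f s‖ ≤ ∑' s, ‖a s • f s‖ := norm_tsum_le_tsum_norm (summable_norm_smul hf a)
      _ ≤ ∑' s, ‖a s‖ * C :=
        (summable_norm_smul hf a).tsum_le_tsum (fun s => by grw [norm_smul, hf s])
          (a.summable_norm.mul_right C)
      _ = C * ‖a‖ := by rw [tsum_mul_right, norm_eq, mul_comm]

lemma lift_delta (f : S → V) (C : ℝ) (hf : ∀ s, ‖f s‖ ≤ C) (s : S) :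
    lift f C hf (delta s) = f s := by
  change ∑' t, delta s t • f t = f s
  rw [tsum_eq_single s fun t ht => by simp [delta_apply, ht]]
  simp [delta_apply]

lemma norm_lift_le (f : S → V) {C : ℝ} (hC : 0 ≤ C) (hf : ∀ s, ‖f s‖ ≤ C) : ‖lift f C hf‖ ≤ C :=
  LinearMap.mkContinuous_norm_le _ hC _

end UniversalProperty

section Multilinear

variable {S : Type*} {V : Type*} [NormedAddCommGroup V] [NormedSpace ℂ V] {n : ℕ}

lemma multilinear_ext {T T' : ContinuousMultilinearMap ℂ (fun _ : Fin n => L1 S) V}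
    (h : ∀ s : Fin n → S, T (delta ∘ s) = T' (delta ∘ s)) : T = T' := by
  induction n with
  | zero =>
    ext a
    obtain rfl : a = delta ∘ Fin.elim0 := Subsingleton.elim _ _
    exact h _
  | succ n ih =>
    apply (continuousMultilinearCurryLeftEquiv ℂ (fun _ : Fin (n + 1) => L1 S) V).injective
    refine clm_ext fun s₀ => ih fun s => ?_
    simpa [Fin.comp_cons] using h (Fin.cons s₀ s)

lemma exists_multilinear_extension [CompleteSpace V] {Φ : (Fin n → S) → V} {C : ℝ} (hC : 0 ≤ C)
    (hΦ : ∀ s, ‖Φ s‖ ≤ C) :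
    ∃ T : ContinuousMultilinearMap ℂ (fun _ : Fin n => L1 S) V,
      ‖T‖ ≤ C ∧ ∀ s, T (delta ∘ s) = Φ s := by
  induction n with
  | zero =>
    refine ⟨ContinuousMultilinearMap.constOfIsEmpty ℂ _ (Φ Fin.elim0), ?_, fun s => ?_⟩
    · simpa using hΦ _
    · exact congrArg Φ (Subsingleton.elim _ _)
  | succ n ih =>
    choose T hT hT' using fun s₀ => ih (Φ := fun s => Φ (Fin.cons s₀ s)) fun s => hΦ _
    refine ⟨(lift T C hT).uncurryLeft, ?_, fun s => ?_⟩
    · rw [ContinuousLinearMap.uncurryLeft_norm]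
      exact norm_lift_le T hC hT
    · rw [ContinuousLinearMap.uncurryLeft_apply, Function.comp_apply, lift_delta,
        ← Fin.comp_tail, hT', Fin.cons_self_tail]

end Multilinear

section Group

variable {G : Type*} [Group G]

lemma delta_mul_delta (g h : G) : delta g * delta h = delta (g * h) := by
  ext x
  rw [mul_apply, tsum_eq_single g fun y hy => by simp [delta_apply, hy]]
  by_cases hx : x = g * h <;> simp [delta_apply, inv_mul_eq_iff_eq_mul, hx]

lemma delta_one_mul (a : L1 G) : delta 1 * a = a := by
  ext x
  rw [mul_apply, tsum_eq_single 1 fun y hy => by simp [delta_apply, hy]]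
  simp [delta_apply]

lemma mul_delta_one (a : L1 G) : a * delta 1 = a := by
  ext x
  rw [mul_apply, tsum_eq_single x fun y hy => by simp [delta_apply, inv_mul_eq_one, hy]]
  simp [delta_apply]

open ContinuousLinearMap (compL mul)

variable (H : Subgroup G)

/-- The inclusion `ℓ¹(H) → ℓ¹(G)`. -/
def incl : L1 H →L[ℂ] L1 G :=
  lift (fun h : H => delta (h : G)) 1 fun h => (norm_delta (h : G)).le

lemma incl_delta (h : H) : incl H (delta h) = delta (h : G) :=
  lift_delta _ _ _ h

lemma incl_mul (a b : L1 H) : incl H (a * b) = incl H a * incl H b := by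
  have h_bilinear : compL ℂ (L1 H) (L1 H) (L1 G) (incl H) ∘L mul ℂ (L1 H) =
      (mul ℂ (L1 G)).bilinearComp (incl H) (incl H) :=
    bilinear_ext fun g h => by simp [incl_delta, delta_mul_delta]
  exact congr($h_bilinear a b)

open Classical in
/-- The restriction map `ℓ¹(G) → ℓ¹(H)`. -/
def restrict : L1 G →L[ℂ] L1 H :=
  lift (fun g => if hg : g ∈ H then delta ⟨g, hg⟩ else 0) 1 fun g => by
    split_ifs <;> simp [norm_delta]

lemma norm_restrict_le : ‖restrict H‖ ≤ 1 :=
  norm_lift_le _ zero_le_one _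

lemma restrict_delta (h : H) : restrict H (delta (h : G)) = delta h := by
  simp [restrict, lift_delta]

lemma restrict_delta_of_notMem {g : G} (hg : g ∉ H) : restrict H (delta g) = 0 := by
  simp [restrict, lift_delta, hg]

lemma restrict_incl_mul (k : L1 H) (a : L1 G) : restrict H (incl H k * a) = k * restrict H a := by
  have h_bilinear : compL ℂ (L1 G) (L1 G) (L1 H) (restrict H) ∘L mul ℂ (L1 G) ∘L incl H =
      (mul ℂ (L1 H)).bilinearComp (.id ℂ (L1 H)) (restrict H) := by
    refine bilinear_ext fun h g => ?_
    by_cases hg : g ∈ H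
    · lift g to H using hg
      simpa [incl_delta, delta_mul_delta, restrict_delta] using restrict_delta H (h * g)
    · have hhg : h * g ∉ H := by rwa [H.mul_mem_cancel_left h.2]
      simp [incl_delta, delta_mul_delta, restrict_delta_of_notMem, hg, hhg]
  exact congr($h_bilinear k a)

lemma restrict_mul_incl (a : L1 G) (k : L1 H) : restrict H (a * incl H k) = restrict H a * k := by
  have h_bilinear : compL ℂ (L1 G) (L1 G) (L1 H) (restrict H) ∘L (mul ℂ (L1 G)).flip ∘L incl H =
      (mul ℂ (L1 H)).flip.bilinearComp (.id ℂ (L1 H)) (restrict H) := by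
    refine bilinear_ext fun h g => ?_
    by_cases hg : g ∈ H
    · lift g to H using hg
      simpa [incl_delta, delta_mul_delta, restrict_delta] using restrict_delta H (g * h)
    · have hgh : g * h ∉ H := by rwa [H.mul_mem_cancel_right h.2]
      simp [incl_delta, delta_mul_delta, restrict_delta_of_notMem, hg, hgh]
  exact congr($h_bilinear k a)

end Group

end L1

lemma exists_equivariant_retraction {G : Type*} [Group G] (H : Subgroup G) :
    ∃ r : G → H, (∀ (h : H) g, r (h * g) = h * r g) ∧ ∀ h : H, r h = h := by
  obtain ⟨S, hS, one_mem⟩ := H.exists_isComplement_right 1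
  have hmul (h : H) (g : G) : (hS.equiv (h * g)).1 = h * (hS.equiv g).1 := by
    rw [hS.equiv_mul_left]
  refine ⟨fun g => (hS.equiv g).1, hmul, fun h => ?_⟩
  have h_one := hmul h 1
  rw [mul_one, hS.equiv_fst_eq_one_of_mem_of_one_mem H.one_mem one_mem] at h_one
  exact h_one.trans (mul_one h)

section ContractNth

variable {A : Type*} [Mul A] {e : A} {n : ℕ}

lemma contractNth_zero_cons_of_one_mul (he : ∀ a, e * a = a) (a : Fin (n + 1) → A) :
    Fin.contractNth 0 (· * ·) (Fin.cons e a : Fin (n + 2) → A) = a := by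
  ext i
  cases i using Fin.cases <;> simp [Fin.contractNth, he]

lemma contractNth_succ_cons (a : Fin (n + 1) → A) (j : Fin n) :
    Fin.contractNth j.succ.castSucc (· * ·) (Fin.cons e a : Fin (n + 2) → A) =
      Fin.cons e (Fin.contractNth j.castSucc (· * ·) a) := by
  ext i
  cases i using Fin.cases <;> simp [Fin.contractNth]

lemma contractNth_last_snoc_of_mul_one (he : ∀ a, a * e = a) (a : Fin (n + 1) → A) :
    Fin.contractNth (Fin.last n).castSucc (· * ·) (Fin.snoc a e : Fin (n + 2) → A) = a := by
  ext i
  cases i using Fin.lastCases <;> simp [Fin.contractNth, he]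

lemma contractNth_castSucc_snoc (a : Fin (n + 1) → A) (j : Fin n) :
    Fin.contractNth j.castSucc.castSucc (· * ·) (Fin.snoc a e : Fin (n + 2) → A) =
      Fin.snoc (Fin.contractNth j.castSucc (· * ·) a) e := by
  ext i
  cases i using Fin.lastCases with
  | last => simp [Fin.contractNth, j.2.not_gt, j.2.ne']
  | cast i => simp only [Fin.contractNth, Fin.val_castSucc, Fin.succ_castSucc, Fin.snoc_castSucc]

end ContractNth

section PartialProd

variable {G : Type*} [Monoid G] {n : ℕ}

lemma smul_partialProd_comp_succ (a : G) (g : Fin (n + 1) → G) :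
    (a • Fin.partialProd g) ∘ Fin.succ = (a * g 0) • Fin.partialProd (Fin.tail g) := by
  ext1 i
  simp [Fin.partialProd_succ', mul_assoc]

lemma smul_partialProd_comp_castSucc (a : G) (g : Fin (n + 1) → G) :
    (a • Fin.partialProd g) ∘ Fin.castSucc = a • Fin.partialProd (Fin.init g) := by
  ext1 i
  simp [Fin.partialProd_init]

lemma smul_partialProd_comp_succAbove (a : G) (g : Fin (n + 1) → G) (i : Fin (n + 1)) :
    (a • Fin.partialProd g) ∘ i.succ.succAbove =
      a • Fin.partialProd (Fin.contractNth i (· * ·) g) := by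
  rw [Fin.partialProd_contractNth]
  rfl

end PartialProd

namespace BanachBimodule

section Cochains

variable {A B Y Z : Type*} [NonUnitalNormedRing A] [NormedSpace ℂ A]
  [NonUnitalNormedRing B] [NormedSpace ℂ B]
  [NormedAddCommGroup Y] [NormedSpace ℂ Y] [NormedAddCommGroup Z] [NormedSpace ℂ Z]

/-- `q : Y → Z` is a map of bimodules along `ι : B → A`: it intertwines the action of `ι b` on `Y`
with the action of `b` on `Z`. -/
structure IsBimoduleHom (M : BanachBimodule A Y) (N : BanachBimodule B Z) (ι : B →L[ℂ] A)
    (q : Y →L[ℂ] Z) : Prop where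
  map_left : ∀ b y, q (M.left (ι b) y) = N.left b (q y)
  map_right : ∀ b y, q (M.right (ι b) y) = N.right b (q y)

/-- The map `T ↦ q ∘ T ∘ (ι × ⋯ × ι)` of cochains. -/
def cochainMap {n : ℕ} (ι : B →L[ℂ] A) (q : Y →L[ℂ] Z) (T : BL n A Y) : BL n B Z :=
  (q.compContinuousMultilinearMap T).compContinuousLinearMap fun _ => ι

lemma cochainMap_apply {n : ℕ} (ι : B →L[ℂ] A) (q : Y →L[ℂ] Z) (T : BL n A Y) (b : Fin n → B) :
    cochainMap ι q T b = q (T (ι ∘ b)) := rfl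

lemma continuous_cochainMap {n : ℕ} (ι : B →L[ℂ] A) (q : Y →L[ℂ] Z) :
    Continuous[strongTopology n A Y, strongTopology n B Z] (cochainMap ι q) := by
  let _ := strongTopology n A Y
  exact continuous_induced_rng.2 <| continuous_pi fun b =>
    q.continuous.comp ((continuous_apply (ι ∘ b)).comp continuous_induced_dom)

variable [IsScalarTower ℂ A A] [SMulCommClass ℂ A A] [IsScalarTower ℂ B B] [SMulCommClass ℂ B B]
  {M : BanachBimodule A Y} {N : BanachBimodule B Z} {ι : B →L[ℂ] A} {q : Y →L[ℂ] Z}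

lemma coboundary_cochainMap (hι : ∀ a b, ι (a * b) = ι a * ι b) (hq : IsBimoduleHom M N ι q)
    {n : ℕ} (T : BL n A Y) :
    N.coboundary n (cochainMap ι q T) = cochainMap ι q (M.coboundary n T) := by
  ext b
  simp [coboundary_apply, cochainMap_apply, hq.map_left, hq.map_right, Fin.comp_tail,
    Fin.comp_init, Fin.comp_contractNth (· * ·) (· * ·) hι]

lemma cochainMap_mem_cocycles (hι : ∀ a b, ι (a * b) = ι a * ι b) (hq : IsBimoduleHom M N ι q)
    {n : ℕ} {T : BL n A Y} (hT : T ∈ M.cocycles n) : cochainMap ι q T ∈ N.cocycles n := by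
  rw [cocycles, LinearMap.mem_ker] at hT ⊢
  rw [coboundary_cochainMap hι hq, hT]
  ext b
  simp [cochainMap_apply]

lemma cochainMap_mem_strongClosure (hι : ∀ a b, ι (a * b) = ι a * ι b)
    (hq : IsBimoduleHom M N ι q) {n : ℕ} {T : BL (n + 1) A Y}
    (hT : T ∈ strongClosure (M.coboundaries (n + 1))) :
    cochainMap ι q T ∈ strongClosure (N.coboundaries (n + 1)) := by
  rw [← SetLike.mem_coe, coe_strongClosure] at hT ⊢
  refine @map_mem_closure _ _ (strongTopology _ A Y) (strongTopology _ B Z) _ _ _ _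
    (continuous_cochainMap ι q) hT ?_
  rintro _ ⟨S, rfl⟩
  exact ⟨cochainMap ι q S, coboundary_cochainMap hι hq S⟩

end Cochains

section HApp

variable {A Y : Type*} [NonUnitalNormedRing A] [NormedSpace ℂ A] [IsScalarTower ℂ A A]
  [SMulCommClass ℂ A A] [NormedAddCommGroup Y] [NormedSpace ℂ Y] (M : BanachBimodule A Y) (n : ℕ)

lemma coboundaries_le_strongClosure : M.coboundaries n ≤ strongClosure (M.coboundaries n) :=
  @subset_closure _ (strongTopology n A Y) _

lemma subsingleton_HApp_iff :
    Subsingleton (HApp n M) ↔ M.cocycles n ≤ strongClosure (M.coboundaries n) := by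
  rw [Submodule.Quotient.subsingleton_iff, Submodule.submoduleOf_eq_top]

end HApp

section Unit

open ContinuousLinearMap (apply)

variable {A Y : Type*} [NonUnitalNormedRing A] [NormedSpace ℂ A] [NormedAddCommGroup Y]
  [NormedSpace ℂ Y] {M : BanachBimodule A Y} {e : A}

lemma IsBimoduleHom.id_sub {q : Y →L[ℂ] Y} (hq : IsBimoduleHom M M (.id ℂ A) q) :
    IsBimoduleHom M M (.id ℂ A) (.id ℂ Y - q) where
  map_left b y := by simpa using hq.map_left b y
  map_right b y := by simpa using hq.map_right b y

lemma isBimoduleHom_left (he : ∀ a, e * a = a) (he' : ∀ a, a * e = a) :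
    IsBimoduleHom M M (.id ℂ A) (M.left e) where
  map_left b y := by simp [← M.left_mul, he, he']
  map_right b y := M.left_right e b y

lemma isBimoduleHom_right (he : ∀ a, e * a = a) (he' : ∀ a, a * e = a) :
    IsBimoduleHom M M (.id ℂ A) (M.right e) where
  map_left b y := (M.left_right b e y).symm
  map_right b y := by simp [← M.right_mul, he, he']

variable [IsScalarTower ℂ A A] [SMulCommClass ℂ A A] {n : ℕ} {T : BL (n + 1) A Y}

lemma coboundary_curryLeft (he : ∀ a, e * a = a) (hT : T ∈ M.cocycles (n + 1))
    (a : Fin (n + 1) → A) :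
    M.coboundary n (T.curryLeft e) a =
      M.left e (T a) - T a + M.left (a 0) (T (Fin.cons e (Fin.tail a))) := by
  have h_cocycle : M.coboundary (n + 1) T (Fin.cons e a) = 0 := congr($hT (Fin.cons e a))
  have h_init : Fin.init (Fin.cons e a : Fin (n + 2) → A) = Fin.cons e (Fin.init a) := by
    ext i
    cases i using Fin.cases <;> simp [Fin.init]
  rw [coboundary_apply, Fin.sum_univ_succ] at h_cocycle
  simp only [Fin.castSucc_zero, contractNth_zero_cons_of_one_mul he, contractNth_succ_cons,
    Fin.cons_zero, Fin.tail_cons, ← Fin.succ_last, Fin.cons_succ, h_init, Fin.val_zero,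
    Fin.val_succ, pow_succ _ (_ + 1), mul_neg_one, neg_smul, Finset.sum_neg_distrib] at h_cocycle
  rw [coboundary_apply]
  simp only [T.curryLeft_apply]
  linear_combination (norm := module) (-1 : ℂ) • h_cocycle

lemma sub_left_mem_coboundaries (he : ∀ a, e * a = a) (he' : ∀ a, a * e = a)
    (hT : T ∈ M.cocycles (n + 1)) :
    T - cochainMap (.id ℂ A) (M.left e) T ∈ M.coboundaries (n + 1) := by
  refine ⟨-cochainMap (.id ℂ A) (.id ℂ Y - M.left e) (T.curryLeft e), ?_⟩
  rw [map_neg, coboundary_cochainMap (fun _ _ => rfl) (isBimoduleHom_left he he').id_sub]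
  ext a
  have h_left (b : A) (y : Y) : M.left e (M.left b y) = M.left b y := by rw [← M.left_mul, he]
  simp [cochainMap_apply, coboundary_curryLeft he hT, h_left]

lemma coboundary_curryRight (he : ∀ a, a * e = a) (hT : T ∈ M.cocycles (n + 1))
    (a : Fin (n + 1) → A) :
    M.coboundary n ((apply ℂ Y e).compContinuousMultilinearMap T.curryRight) a =
      (-1 : ℂ) ^ n • (T a - M.right e (T a) -
        M.right (a (Fin.last n)) (T (Fin.snoc (Fin.init a) e))) := by
  have h_cocycle : M.coboundary (n + 1) T (Fin.snoc a e) = 0 := congr($hT (Fin.snoc a e))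
  have h_tail : Fin.tail (Fin.snoc a e : Fin (n + 2) → A) = Fin.snoc (Fin.tail a) e := by
    ext i
    cases i using Fin.lastCases <;> simp [Fin.tail, ← Fin.castSucc_succ]
  rw [coboundary_apply, Fin.sum_univ_castSucc] at h_cocycle
  simp only [contractNth_last_snoc_of_mul_one he, contractNth_castSucc_snoc,
    ← Fin.castSucc_zero, Fin.snoc_castSucc, Fin.snoc_last, Fin.init_snoc, h_tail, Fin.val_castSucc,
    Fin.val_last, pow_succ _ (n + 1)] at h_cocycle
  rw [coboundary_apply]
  simp only [ContinuousLinearMap.compContinuousMultilinearMap_coe, Function.comp_apply,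
    ContinuousLinearMap.apply_apply, T.curryRight_apply]
  linear_combination (norm := module) h_cocycle

lemma sub_right_mem_coboundaries (he : ∀ a, e * a = a) (he' : ∀ a, a * e = a)
    (hT : T ∈ M.cocycles (n + 1)) :
    T - cochainMap (.id ℂ A) (M.right e) T ∈ M.coboundaries (n + 1) := by
  refine ⟨(-1 : ℂ) ^ n • cochainMap (.id ℂ A) (.id ℂ Y - M.right e)
    ((apply ℂ Y e).compContinuousMultilinearMap T.curryRight), ?_⟩
  rw [map_smul, coboundary_cochainMap (fun _ _ => rfl) (isBimoduleHom_right he he').id_sub]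
  ext a
  have h_right (b : A) (y : Y) : M.right e (M.right b y) = M.right b y := by
    rw [← M.right_mul, he']
  simp [cochainMap_apply, coboundary_curryRight he' hT, h_right, smul_smul, ← mul_pow]

lemma sub_left_right_mem_coboundaries (he : ∀ a, e * a = a) (he' : ∀ a, a * e = a)
    (hT : T ∈ M.cocycles (n + 1)) :
    T - cochainMap (.id ℂ A) (M.left e ∘L M.right e) T ∈ M.coboundaries (n + 1) := by
  rw [← sub_add_sub_cancel T (cochainMap (.id ℂ A) (M.right e) T)]
  exact add_mem (sub_right_mem_coboundaries he he' hT) (sub_left_mem_coboundaries he he'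
    (cochainMap_mem_cocycles (fun _ _ => rfl) (isBimoduleHom_right he he') hT))

end Unit

section Bidual

open ContinuousLinearMap (compL)

variable {A B X : Type*} {E : Type v} [NonUnitalNormedRing A] [NormedSpace ℂ A]
  [NonUnitalNormedRing B] [NormedSpace ℂ B] [NormedAddCommGroup X] [NormedSpace ℂ X]
  [NormedAddCommGroup E] [NormedSpace ℂ E]

/-- The weak-* continuous extension to the bidual of a map into a dual space. -/
def bidualExtension (p : E →L[ℂ] StrongDual ℂ X) :
    StrongDual ℂ (StrongDual ℂ E) →L[ℂ] StrongDual ℂ X :=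
  (compL ℂ X (StrongDual ℂ E) ℂ).flip p.flip

variable {M : BanachBimodule B X} {N : BanachBimodule A E} {ι : B →L[ℂ] A}
  {p : E →L[ℂ] StrongDual ℂ X}

lemma IsBimoduleHom.bidualExtension (hp : IsBimoduleHom N M.dual ι p) :
    IsBimoduleHom N.dual.dual M.dual ι (bidualExtension p) where
  map_left b Λ := by
    ext x
    change Λ (N.dual.right (ι b) (p.flip x)) = Λ (p.flip (M.right b x))
    congr 1
    ext f
    exact congr($(hp.map_left b f) x)
  map_right b Λ := by
    ext x
    change Λ (N.dual.left (ι b) (p.flip x)) = Λ (p.flip (M.left b x))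
    congr 1
    ext f
    exact congr($(hp.map_right b f) x)

lemma isBimoduleHom_inclusionInDoubleDual :
    IsBimoduleHom N N.dual.dual (.id ℂ A) (NormedSpace.inclusionInDoubleDual ℂ E) :=
  ⟨fun _ _ => rfl, fun _ _ => rfl⟩

variable [IsScalarTower ℂ A A] [SMulCommClass ℂ A A] [IsScalarTower ℂ B B] [SMulCommClass ℂ B B]

lemma cochainMap_mem_strongClosure_of_mem_cocycles {n : ℕ}
    (hA : ∀ (Y : Type v) [NormedAddCommGroup Y] [NormedSpace ℂ Y] [CompleteSpace Y]
      (M : BanachBimodule A Y), Subsingleton (HApp (n + 1) M.dual))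
    (hι : ∀ a b, ι (a * b) = ι a * ι b) (hp : IsBimoduleHom N M.dual ι p) {F : BL (n + 1) A E}
    (hF : F ∈ N.cocycles (n + 1)) :
    cochainMap ι p F ∈ strongClosure (M.dual.coboundaries (n + 1)) := by
  have hJF := cochainMap_mem_cocycles (fun _ _ => rfl)
    (isBimoduleHom_inclusionInDoubleDual (N := N)) hF
  exact cochainMap_mem_strongClosure hι hp.bidualExtension
    ((subsingleton_HApp_iff _ _).1 (hA _ N.dual) hJF)

end Bidual

set_option maxSynthPendingDepth 3

section Restrict

variable {A V : Type*} [NonUnitalNormedRing A] [NormedSpace ℂ A] [NormedAddCommGroup V]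
  [NormedSpace ℂ V]

/-- The restriction of the actions of a Banach bimodule to a sub-bimodule. -/
def restrictSubmodule (M : BanachBimodule A V) (W : Submodule ℂ V)
    (hleft : ∀ a, ∀ w ∈ W, M.left a w ∈ W) (hright : ∀ a, ∀ w ∈ W, M.right a w ∈ W) :
    BanachBimodule A W where
  left := LinearMap.mkContinuous₂
    (.mk₂ ℂ (fun a w => ⟨M.left a w, hleft a w w.2⟩)
      (fun _ _ _ => by ext; simp) (fun _ _ _ => by ext; simp) (fun _ _ _ => by ext; simp)
      fun _ _ _ => by ext; simp) ‖M.left‖ fun a w => M.left.le_opNorm₂ a w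
  right := LinearMap.mkContinuous₂
    (.mk₂ ℂ (fun a w => ⟨M.right a w, hright a w w.2⟩)
      (fun _ _ _ => by ext; simp) (fun _ _ _ => by ext; simp) (fun _ _ _ => by ext; simp)
      fun _ _ _ => by ext; simp) ‖M.right‖ fun a w => M.right.le_opNorm₂ a w
  left_mul a b w := Subtype.ext (M.left_mul a b w)
  right_mul a b w := Subtype.ext (M.right_mul a b w)
  left_right a b w := Subtype.ext (M.left_right a b w)

end Restrict

section Coinduced

open ContinuousLinearMap (apply compL mul)

variable {A B V : Type*} [NonUnitalNormedRing A] [NormedSpace ℂ A] [NonUnitalNormedRing B]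
  [NormedSpace ℂ B] [NormedAddCommGroup V] [NormedSpace ℂ V] (N : BanachBimodule B V)
  (ι : B →L[ℂ] A)

/-- The bounded bilinear maps `F : A × A → V` that are `B`-equivariant along `ι : B → A` in the
outer sides of their arguments. -/
def coind : Submodule ℂ (A →L[ℂ] A →L[ℂ] V) where
  carrier := {F | ∀ k a b, F (ι k * a) b = N.left k (F a b) ∧ F a (b * ι k) = N.right k (F a b)}
  add_mem' hF hF' k a b := by
    simp [(hF k a b).1, (hF k a b).2, (hF' k a b).1, (hF' k a b).2]
  zero_mem' k a b := by simp
  smul_mem' c F hF k a b := by simp [(hF k a b).1, (hF k a b).2]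

lemma isClosed_coind : IsClosed (N.coind ι : Set (A →L[ℂ] A →L[ℂ] V)) := by
  simp only [coind, Submodule.coe_set_mk, AddSubmonoid.coe_set_mk, AddSubsemigroup.coe_set_mk,
    Set.ofPred_forall, Set.ofPred_and]
  refine isClosed_iInter fun k => isClosed_iInter fun a => isClosed_iInter fun b => ?_
  exact (isClosed_eq (by fun_prop) (by fun_prop)).inter (isClosed_eq (by fun_prop) (by fun_prop))

instance [CompleteSpace V] : CompleteSpace (N.coind ι) :=
  (N.isClosed_coind ι).completeSpace_coe

/-- The evaluation `F ↦ F(a, b)` on the coinduced bimodule. -/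
def coindEval (a b : A) : N.coind ι →L[ℂ] V :=
  apply ℂ V b ∘L apply ℂ (A →L[ℂ] V) a ∘L (N.coind ι).subtypeL

variable {N ι} in
lemma coindEval_apply (a b : A) (F : N.coind ι) : N.coindEval ι a b F = F.1 a b := rfl

variable [IsScalarTower ℂ A A] [SMulCommClass ℂ A A]

variable (A V) in
/-- The bimodule of bounded bilinear maps `F : A × A → V`, with the actions
`(x · F)(a, b) = F(ax, b)` and `(F · y)(a, b) = F(a, yb)`. -/
def bilinBimodule : BanachBimodule A (A →L[ℂ] A →L[ℂ] V) where
  left := (compL ℂ A A (A →L[ℂ] V)).flip ∘L (mul ℂ A).flip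
  right := compL ℂ A (A →L[ℂ] V) (A →L[ℂ] V) ∘L (compL ℂ A A V).flip ∘L mul ℂ A
  left_mul x y F := by ext a b; simp [mul_assoc]
  right_mul x y F := by ext a b; simp [mul_assoc]
  left_right x y F := rfl

lemma bilinBimodule_left_apply (x : A) (F : A →L[ℂ] A →L[ℂ] V) (a b : A) :
    (bilinBimodule A V).left x F a b = F (a * x) b := rfl

lemma bilinBimodule_right_apply (y : A) (F : A →L[ℂ] A →L[ℂ] V) (a b : A) :
    (bilinBimodule A V).right y F a b = F a (y * b) := rfl

/-- The coinduced `A`-bimodule of a `B`-bimodule along `ι : B → A`. -/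
def coindBimodule : BanachBimodule A (N.coind ι) :=
  (bilinBimodule A V).restrictSubmodule (N.coind ι)
    (fun x F hF k a b => by
      simpa [bilinBimodule_left_apply, mul_assoc] using hF k (a * x) b)
    (fun y F hF k a b => by
      simpa [bilinBimodule_right_apply, mul_assoc] using hF k a (y * b))

variable {N ι}

lemma coindEval_left (x : A) (F : N.coind ι) (a b : A) :
    N.coindEval ι a b ((N.coindBimodule ι).left x F) = N.coindEval ι (a * x) b F := rfl

lemma coindEval_right (y : A) (F : N.coind ι) (a b : A) :
    N.coindEval ι a b ((N.coindBimodule ι).right y F) = N.coindEval ι a (y * b) F := rfl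

lemma isBimoduleHom_coindEval {e : A} (he : ∀ a, e * a = a) (he' : ∀ a, a * e = a) :
    IsBimoduleHom (N.coindBimodule ι) N ι (N.coindEval ι e e) where
  map_left k F := by
    rw [coindEval_left, he, coindEval_apply, coindEval_apply, ← (F.2 k e e).1, he']
  map_right k F := by
    rw [coindEval_right, he', coindEval_apply, coindEval_apply, ← (F.2 k e e).2, he]

end Coinduced

section Homogenize

open L1
open ContinuousLinearMap (mul)

variable {K V : Type*} [Group K] [NormedAddCommGroup V] [NormedSpace ℂ V]
  (N : BanachBimodule (L1 K) V) {n : ℕ} (T : BL n (L1 K) V)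

/-- The homogeneous form of a cochain on `ℓ¹(K)`: it sends `(q₀, …, qₙ)` to the map
`c ↦ q₀ · T(q₀⁻¹q₁, …, qₙ₋₁⁻¹qₙ) · qₙ⁻¹c`. -/
def homogenize (q : Fin (n + 1) → K) : L1 K →L[ℂ] V :=
  N.left (delta (q 0)) ∘L N.right.flip (T fun i => delta ((q i.castSucc)⁻¹ * q i.succ)) ∘L
    mul ℂ (L1 K) (delta (q (Fin.last n))⁻¹)

lemma homogenize_apply (q : Fin (n + 1) → K) (c : L1 K) :
    N.homogenize T q c = N.left (delta (q 0)) (N.right (delta (q (Fin.last n))⁻¹ * c)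
      (T fun i => delta ((q i.castSucc)⁻¹ * q i.succ))) := rfl

lemma norm_homogenize_le (q : Fin (n + 1) → K) :
    ‖N.homogenize T q‖ ≤ ‖N.left‖ * ‖N.right‖ * ‖T‖ := by
  refine ContinuousLinearMap.opNorm_le_bound _ (by positivity) fun c => ?_
  have hT : ‖T fun i => delta ((q i.castSucc)⁻¹ * q i.succ)‖ ≤ ‖T‖ := by
    simpa [norm_delta] using T.le_opNorm fun i => delta ((q i.castSucc)⁻¹ * q i.succ)
  rw [homogenize_apply]
  grw [N.left.le_opNorm₂, N.right.le_opNorm₂, hT, norm_mul_le]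
  simp only [norm_delta]
  exact le_of_eq (by ring)

lemma homogenize_smul_mul (k : K) (q : Fin (n + 1) → K) (c : L1 K) :
    N.homogenize T (k • q) (delta k * c) = N.left (delta k) (N.homogenize T q c) := by
  simp [homogenize_apply, mul_assoc, ← N.left_mul, ← mul_assoc (delta _), delta_mul_delta]

lemma homogenize_mul (q : Fin (n + 1) → K) (b c : L1 K) :
    N.homogenize T q (b * c) = N.right c (N.homogenize T q b) := by
  simp [homogenize_apply, ← mul_assoc, N.right_mul, N.left_right]

lemma homogenize_smul_partialProd (k : K) (h : Fin n → K) (c : L1 K) :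
    N.homogenize T (k • Fin.partialProd h) c =
      N.left (delta k) (N.right (delta (k * Fin.partialProd h (Fin.last n))⁻¹ * c)
        (T (delta ∘ h))) := by
  have h_increments : (fun i => delta (((k • Fin.partialProd h) i.castSucc)⁻¹ *
      (k • Fin.partialProd h) i.succ)) = delta ∘ h := by
    ext1 i
    simp [mul_assoc, ← Fin.partialProd_right_inv h i]
  rw [homogenize_apply, h_increments]
  simp

lemma homogenize_smul_partialProd_comp_succ (k : K) (h : Fin (n + 1) → K) (c : L1 K) :
    N.homogenize T ((k • Fin.partialProd h) ∘ Fin.succ) c =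
      N.left (delta k) (N.right (delta (k * Fin.partialProd h (Fin.last (n + 1)))⁻¹ * c)
        (N.left (delta (h 0)) (T (delta ∘ Fin.tail h)))) := by
  rw [smul_partialProd_comp_succ, homogenize_smul_partialProd, ← delta_mul_delta, N.left_mul,
    N.left_right (delta _), ← Fin.succ_last, Fin.partialProd_succ', mul_assoc]

lemma homogenize_smul_partialProd_comp_succAbove (k : K) (h : Fin (n + 1) → K) (c : L1 K)
    (i : Fin n) :
    N.homogenize T ((k • Fin.partialProd h) ∘ i.castSucc.succ.succAbove) c =
      N.left (delta k) (N.right (delta (k * Fin.partialProd h (Fin.last (n + 1)))⁻¹ * c)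
        (T (delta ∘ Fin.contractNth i.castSucc (· * ·) h))) := by
  rw [smul_partialProd_comp_succAbove, homogenize_smul_partialProd, Fin.partialProd_contractNth]
  simp

lemma homogenize_smul_partialProd_comp_castSucc (k : K) (h : Fin (n + 1) → K) (c : L1 K) :
    N.homogenize T ((k • Fin.partialProd h) ∘ Fin.castSucc) c =
      N.left (delta k) (N.right (delta (k * Fin.partialProd h (Fin.last (n + 1)))⁻¹ * c)
        (N.right (delta (h (Fin.last n))) (T (delta ∘ Fin.init h)))) := by
  rw [smul_partialProd_comp_castSucc, homogenize_smul_partialProd]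
  simp [← N.right_mul, ← mul_assoc, delta_mul_delta, ← Fin.succ_last, Fin.partialProd_succ,
    Fin.partialProd_init]

variable {N T}

lemma sum_homogenize_succAbove (hT : T ∈ N.cocycles n) (q : Fin (n + 2) → K) (c : L1 K) :
    ∑ j : Fin (n + 2), (-1 : ℂ) ^ (j : ℕ) • N.homogenize T (q ∘ j.succAbove) c = 0 := by
  obtain ⟨k, h, rfl⟩ : ∃ k h, q = k • Fin.partialProd h :=
    ⟨_, _, (Fin.partialProd_left_inv q).symm⟩
  let w : V →L[ℂ] V :=
    N.left (delta k) ∘L N.right (delta (k * Fin.partialProd h (Fin.last (n + 1)))⁻¹ * c)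
  have h_image : w (N.coboundary n T (delta ∘ h)) = w 0 := congr(w ($hT (delta ∘ h)))
  rw [Fin.sum_univ_succ, Fin.sum_univ_castSucc]
  simp only [Fin.succ_last, Fin.succAbove_zero, Fin.succAbove_last,
    homogenize_smul_partialProd_comp_succ, homogenize_smul_partialProd_comp_succAbove,
    homogenize_smul_partialProd_comp_castSucc]
  simpa [w, coboundary_apply, Fin.comp_tail, Fin.comp_init, Fin.comp_contractNth (· * ·) (· * ·)
    (fun g h => (delta_mul_delta g h).symm), add_assoc] using h_image

end Homogenize

section Extension

open L1
open ContinuousLinearMap (compL mul)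

variable {G V : Type*} [Group G] {H : Subgroup G} [NormedAddCommGroup V] [NormedSpace ℂ V]
  (N : BanachBimodule (L1 H) V) {n : ℕ} (T : BL n (L1 H) V) {r : G → H}

/-- The homogeneous form of `T` pulled back along `r : G → H`. The translation by `qₙ` before the
restriction to `H` is what makes right multiplication in `ℓ¹(G)` by a point mass a face map. -/
def retractHomogenize (r : G → H) (q : Fin (n + 1) → G) : L1 G →L[ℂ] V :=
  N.homogenize T (r ∘ q) ∘L restrict H ∘L mul ℂ (L1 G) (delta (q (Fin.last n)))

lemma retractHomogenize_apply (q : Fin (n + 1) → G) (b : L1 G) :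
    N.retractHomogenize T r q b =
      N.homogenize T (r ∘ q) (restrict H (delta (q (Fin.last n)) * b)) := rfl

lemma norm_retractHomogenize_le (q : Fin (n + 1) → G) :
    ‖N.retractHomogenize T r q‖ ≤ ‖N.left‖ * ‖N.right‖ * ‖T‖ := by
  refine ContinuousLinearMap.opNorm_le_bound _ (by positivity) fun b => ?_
  rw [retractHomogenize_apply]
  grw [ContinuousLinearMap.le_opNorm, ContinuousLinearMap.le_opNorm, norm_homogenize_le,
    norm_restrict_le, norm_mul_le, norm_delta, one_mul, one_mul]

lemma retractHomogenize_mul_incl (q : Fin (n + 1) → G) (b : L1 G) (k : L1 H) :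
    N.retractHomogenize T r q (b * incl H k) = N.right k (N.retractHomogenize T r q b) := by
  rw [retractHomogenize_apply, ← mul_assoc, restrict_mul_incl, homogenize_mul,
    retractHomogenize_apply]

lemma retractHomogenize_smul (hr : ∀ (h : H) g, r (h * g) = h * r g) (k : H)
    (q : Fin (n + 1) → G) (b : L1 G) :
    N.retractHomogenize T r ((k : G) • q) b =
      N.left (delta k) (N.retractHomogenize T r q b) := by
  have h_comp : r ∘ ((k : G) • q) = k • (r ∘ q) := by
    ext1 i
    exact hr k (q i)
  rw [retractHomogenize_apply, h_comp, Pi.smul_apply, smul_eq_mul, ← delta_mul_delta, mul_assoc,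
    ← incl_delta, restrict_incl_mul, homogenize_smul_mul, retractHomogenize_apply]

variable [CompleteSpace V]

/-- The value at `(δ_{g₁}, …, δ_{gₙ})` of the cochain on `ℓ¹(G)` that extends `T`: a bilinear map
whose value at `(δ_a, b)` is that of `retractHomogenize` at `(a, ag₁, …, ag₁⋯gₙ)` and `b`. -/
def retractExtend (r : G → H) (g : Fin n → G) : L1 G →L[ℂ] L1 G →L[ℂ] V :=
  lift (fun a : G => N.retractHomogenize T r (a • Fin.partialProd g)) _
    fun _ => N.norm_retractHomogenize_le T _

lemma retractExtend_delta (g : Fin n → G) (a : G) :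
    N.retractExtend T r g (delta a) = N.retractHomogenize T r (a • Fin.partialProd g) :=
  lift_delta ..

lemma norm_retractExtend_le (g : Fin n → G) :
    ‖N.retractExtend T r g‖ ≤ ‖N.left‖ * ‖N.right‖ * ‖T‖ :=
  norm_lift_le _ (by positivity) _

lemma retractExtend_mem_coind (hr : ∀ (h : H) g, r (h * g) = h * r g) (g : Fin n → G) :
    N.retractExtend T r g ∈ N.coind (incl H) := by
  intro k a b
  have h_left : compL ℂ _ _ _ ((N.retractExtend T r g).flip b) ∘L mul ℂ (L1 G) ∘L incl H =
      (compL ℂ _ _ _).flip ((N.retractExtend T r g).flip b) ∘L N.left := by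
    refine bilinear_ext fun k a => ?_
    simp [incl_delta, delta_mul_delta, retractExtend_delta, mul_smul,
      retractHomogenize_smul N T hr]
  have h_right : (N.retractExtend T r g).flip (b * incl H k) =
      N.right k ∘L (N.retractExtend T r g).flip b := by
    refine clm_ext fun a => ?_
    simp [retractExtend_delta, retractHomogenize_mul_incl]
  exact ⟨congr($h_left k a), congr($h_right a)⟩

variable {N T}

lemma mem_cocycles_of_apply_delta_eq_retractExtend (hT : T ∈ N.cocycles n)
    {F : BL n (L1 G) (N.coind (incl H))} (hF : ∀ g, (F (delta ∘ g)).1 = N.retractExtend T r g) :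
    F ∈ (N.coindBimodule (incl H)).cocycles n := by
  refine multilinear_ext fun g => ?_
  ext1
  refine clm_ext fun a => ?_
  ext b
  set q := a • Fin.partialProd g with hq
  set c := restrict H (delta (q (Fin.last _)) * b) with hc
  have h_faces := sum_homogenize_succAbove hT (r ∘ q) c
  have h_first : N.retractExtend T r (Fin.tail g) (delta (a * g 0)) b =
      N.homogenize T ((r ∘ q) ∘ Fin.succ) c := by
    rw [retractExtend_delta, ← smul_partialProd_comp_succ]
    rfl
  have h_middle (i : Fin n) :
      N.retractExtend T r (Fin.contractNth i.castSucc (· * ·) g) (delta a) b =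
        N.homogenize T ((r ∘ q) ∘ i.castSucc.succ.succAbove) c := by
    rw [retractExtend_delta, ← smul_partialProd_comp_succAbove, retractHomogenize_apply]
    simp [hc, hq, Function.comp_assoc]
  have h_last : N.retractExtend T r (Fin.init g) (delta a) (delta (g (Fin.last n)) * b) =
      N.homogenize T ((r ∘ q) ∘ Fin.castSucc) c := by
    rw [retractExtend_delta, ← smul_partialProd_comp_castSucc, retractHomogenize_apply,
      ← mul_assoc, delta_mul_delta]
    simp [hc, hq, Function.comp_assoc, ← Fin.succ_last, Fin.partialProd_succ, mul_assoc]
  rw [Fin.sum_univ_succ, Fin.sum_univ_castSucc] at h_faces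
  change N.coindEval (incl H) (delta a) b
    ((N.coindBimodule (incl H)).coboundary n F (delta ∘ g)) = 0
  simp only [coboundary_apply, map_add, map_sum, map_smul, coindEval_left, coindEval_right,
    ← Fin.comp_tail, ← Fin.comp_init, ← Fin.comp_contractNth (· * ·) (· * ·)
    (fun g h => (delta_mul_delta g h).symm), Function.comp_apply, delta_mul_delta]
  simp only [coindEval_apply, hF, h_first, h_middle, h_last]
  simpa [add_assoc] using h_faces

lemma cochainMap_coindEval_eq (hr : ∀ h : H, r h = h)
    {F : BL n (L1 G) (N.coind (incl H))} (hF : ∀ g, (F (delta ∘ g)).1 = N.retractExtend T r g) :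
    cochainMap (incl H) (N.coindEval (incl H) (delta 1) (delta 1)) F =
      cochainMap (.id ℂ _) (N.left (delta 1) ∘L N.right (delta 1)) T := by
  refine multilinear_ext fun h => ?_
  have h_incl : incl H ∘ delta ∘ h = delta ∘ (fun i => (h i : G)) := by
    ext1 i
    exact incl_delta H (h i)
  have h_coe (j : Fin (n + 1)) : Fin.partialProd (fun i => (h i : G)) j = Fin.partialProd h j := by
    induction j using Fin.induction with
    | zero => simp
    | succ j ih => simp [Fin.partialProd_succ, ih]
  have h_retract : r ∘ ((1 : G) • Fin.partialProd fun i => (h i : G)) =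
      (1 : H) • Fin.partialProd h := by
    ext1 j
    simp [h_coe, hr]
  rw [cochainMap_apply, cochainMap_apply, h_incl, coindEval_apply, hF, retractExtend_delta,
    retractHomogenize_apply, h_retract, homogenize_smul_partialProd]
  simp [h_coe, delta_mul_delta, restrict_delta]

variable (N T)

lemma exists_cocycle_cochainMap_coindEval_eq (hT : T ∈ N.cocycles n) :
    ∃ F ∈ (N.coindBimodule (incl H)).cocycles n,
      cochainMap (incl H) (N.coindEval (incl H) (delta 1) (delta 1)) F =
        cochainMap (.id ℂ _) (N.left (delta 1) ∘L N.right (delta 1)) T := by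
  obtain ⟨r, hr, hr_coe⟩ := exists_equivariant_retraction H
  obtain ⟨F, -, hF⟩ := exists_multilinear_extension
    (Φ := fun g => (⟨N.retractExtend T r g, N.retractExtend_mem_coind T hr g⟩ : N.coind (incl H)))
    (by positivity) fun g => N.norm_retractExtend_le T g
  exact ⟨F, mem_cocycles_of_apply_delta_eq_retractExtend hT fun g => congr($(hF g).1),
    cochainMap_coindEval_eq hr_coe fun g => congr($(hF g).1)⟩

end Extension

section Subgroup

open L1

variable {G : Type u} [Group G] {H : Subgroup G} {X : Type v} [NormedAddCommGroup X]
  [NormedSpace ℂ X] {M : BanachBimodule (L1 H) X} {n : ℕ}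

lemma cochainMap_left_right_mem_strongClosure
    (hG : ∀ (Y : Type (max u v)) [NormedAddCommGroup Y] [NormedSpace ℂ Y] [CompleteSpace Y]
      (M : BanachBimodule (L1 G) Y), Subsingleton (HApp (n + 1) M.dual))
    {T : BL (n + 1) (L1 H) (StrongDual ℂ X)} (hT : T ∈ M.dual.cocycles (n + 1)) :
    cochainMap (.id ℂ _) (M.dual.left (delta 1) ∘L M.dual.right (delta 1)) T ∈
      strongClosure (M.dual.coboundaries (n + 1)) := by
  obtain ⟨F, hF, hFT⟩ := M.dual.exists_cocycle_cochainMap_coindEval_eq T hT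
  have h_hom : IsBimoduleHom (M.dual.coindBimodule (incl H)) M.dual (incl H)
      (M.dual.coindEval (incl H) (delta 1) (delta 1)) :=
    isBimoduleHom_coindEval delta_one_mul mul_delta_one
  rw [← hFT]
  exact cochainMap_mem_strongClosure_of_mem_cocycles hG (incl_mul H) h_hom hF

end Subgroup

end BanachBimodule

end

open BanachBimodule in
theorem mainTheorem7_general {G : Type u} [Group G] (H : Subgroup G) (n : ℕ)
    (hG : ∀ (X : Type (max u v)) [NormedAddCommGroup X] [NormedSpace ℂ X] [CompleteSpace X]
      (M : BanachBimodule (L1 G) X), Subsingleton (HApp (n + 1) M.dual))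
    (X : Type v) [NormedAddCommGroup X] [NormedSpace ℂ X] (M : BanachBimodule (L1 H) X) :
    Subsingleton (HApp (n + 1) M.dual) := by
  rw [subsingleton_HApp_iff]
  intro T hT
  have h_compressed := cochainMap_left_right_mem_strongClosure hG hT
  have h_diff := coboundaries_le_strongClosure _ _ <|
    sub_left_right_mem_coboundaries L1.delta_one_mul L1.mul_delta_one hT
  exact (Submodule.sub_mem_iff_left _ h_compressed).1 h_diff

/-- Let `H` be a subgroup of a discrete group `G`. If `H²_app(ℓ¹(G), X*) = 0` for every Banach
`ℓ¹(G)`-bimodule `X`, then `H²_app(ℓ¹(H), X*) = 0` for every Banach `ℓ¹(H)`-bimodule `X`. -/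
theorem mainTheorem7 {G : Type u} [Group G] (H : Subgroup G)
    (hG : ∀ (X : Type (max u v)) [NormedAddCommGroup X] [NormedSpace ℂ X] [CompleteSpace X]
      (M : BanachBimodule (L1 G) X), Subsingleton (HApp 2 M.dual)) :
    ∀ (X : Type (max u v)) [NormedAddCommGroup X] [NormedSpace ℂ X] [CompleteSpace X]
      (M : BanachBimodule (L1 H) X), Subsingleton (HApp 2 M.dual) := by
  intro X _ _ _ M
  exact mainTheorem7_general.{u, max u v} H 1 hG X M
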